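/- Let $a<b$ be real numbers, let $m\ge 1$ be an integer, and let $k\in L^2((a,b)^2)$ be a (real- or complex-valued) kernel. Let $K:L^2(a,b)\to L^2(a,b)$ be the integral operator $$(Kx)(s)=\int_a^b k(s,t)\,x(t)\,\mathrm{d}t,\qquad s\in(a,b).$$ Suppose that the range of $K$ is contained in the Sobolev space $H^m(a,b)$ of functions in $L^2(a,b)$ whose weak derivatives of all orders up to $m$ lie in $L^2(a,b)$. Let $s_1(K)\ge s_2(K)\ge\cdots\ge 0$ be the singular values of $K$, that is, the square roots of the positive eigenvalues of $K^*K$, in non-increasing order and repeated according to multiplicity, with $s_j(K)=0$ if there are fewer than $j$ of them. Then there is a constant $C>0$, independent of $j$, such that $$s_j(K)\le C\,j^{-m}\qquad\text{for all } j=1,2,3,\dots$$ -/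

import Mathlib

open MeasureTheory
open scoped ENNReal ContDiff

noncomputable section

/-- Lebesgue measure on the open interval `(a, b)`. -/
abbrev intervalMeasure (a b : ℝ) : Measure ℝ := volume.restrict (Set.Ioo a b)

/-- The Hilbert space `L²(a, b)` of (classes of) `𝕜`-valued functions, `𝕜 = ℝ` or `ℂ`. -/
abbrev L2 (𝕜 : Type*) [RCLike 𝕜] (a b : ℝ) : Type _ := Lp 𝕜 2 (intervalMeasure a b)

section IntegralOperator

variable {𝕜 : Type*} [RCLike 𝕜] {μ : Measure ℝ}

/-- Cauchy--Schwarz for one section of the kernel. -/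
theorem kernel_section_bound {f g : ℝ → 𝕜} (hf : AEStronglyMeasurable f μ)
    (hg : AEStronglyMeasurable g μ) :
    (∫⁻ t, ‖f t * g t‖ₑ ∂μ) ^ 2 ≤ (∫⁻ t, ‖f t‖ₑ ^ 2 ∂μ) * ∫⁻ t, ‖g t‖ₑ ^ 2 ∂μ := by
  have h := ENNReal.lintegral_mul_le_Lp_mul_Lq μ Real.HolderConjugate.two_two
    hf.enorm hg.enorm
  have h2 := ENNReal.rpow_le_rpow h (show (0 : ℝ) ≤ 2 by norm_num)
  rw [ENNReal.mul_rpow_of_nonneg _ _ (by norm_num), ← ENNReal.rpow_mul, ← ENNReal.rpow_mul] at h2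
  simpa [enorm_mul] using h2

theorem eLpNorm_two_sq {X : Type*} [MeasurableSpace X] {ν : Measure X} (f : X → 𝕜) :
    eLpNorm f 2 ν ^ 2 = ∫⁻ t, ‖f t‖ₑ ^ 2 ∂ν := by
  have := eLpNorm_nnreal_pow_eq_lintegral (f := f) (μ := ν) (p := 2) (by norm_num)
  simpa using this

variable [SFinite μ]

theorem kernel_sections {k : ℝ × ℝ → 𝕜} (hk : MemLp k 2 (μ.prod μ)) :
    ∀ᵐ s ∂μ, MemLp (fun t => k (s, t)) 2 μ := by
  have hm := hk.1.prodMk_left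
  have hfin : ∫⁻ s, ∫⁻ t, ‖k (s, t)‖ₑ ^ 2 ∂μ ∂μ ≠ ⊤ := by
    rw [← lintegral_prod _ (hk.1.enorm.pow_const 2), ← eLpNorm_two_sq]
    exact ENNReal.pow_ne_top hk.2.ne
  have hae := ae_lt_top' ((hk.1.enorm.pow_const 2).lintegral_prod_right') hfin
  filter_upwards [hm, hae] with s h1 h2
  refine ⟨h1, ?_⟩
  rw [← eLpNorm_two_sq] at h2
  by_contra hne
  rw [not_lt, top_le_iff] at hne
  simp [hne] at h2

theorem integralOperator_bound {k : ℝ × ℝ → 𝕜} (hk : MemLp k 2 (μ.prod μ)) {x : ℝ → 𝕜}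
    (hx : MemLp x 2 μ) :
    eLpNorm (fun s => ∫ t, k (s, t) * x t ∂μ) 2 μ ≤ eLpNorm k 2 (μ.prod μ) * eLpNorm x 2 μ := by
  rw [← ENNReal.pow_le_pow_left_iff (two_ne_zero), mul_pow, eLpNorm_two_sq, eLpNorm_two_sq,
    eLpNorm_two_sq, lintegral_prod _ (hk.1.enorm.pow_const 2),
    ← lintegral_mul_const'' _ ((hk.1.enorm.pow_const 2).lintegral_prod_right')]
  refine lintegral_mono_ae ?_
  filter_upwards [hk.1.prodMk_left] with s hs
  exact (pow_le_pow_left' (enorm_integral_le_lintegral_enorm _) 2).trans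
    (kernel_section_bound hs hx.1)

theorem integralOperator_memLp {k : ℝ × ℝ → 𝕜} (hk : MemLp k 2 (μ.prod μ)) {x : ℝ → 𝕜}
    (hx : MemLp x 2 μ) : MemLp (fun s => ∫ t, k (s, t) * x t ∂μ) 2 μ := by
  refine ⟨?_, (integralOperator_bound hk hx).trans_lt (ENNReal.mul_lt_top hk.2 hx.2)⟩
  have : AEStronglyMeasurable (fun z : ℝ × ℝ => k z * x z.2) (μ.prod μ) := hk.1.mul hx.1.comp_snd
  exact this.integral_prod_right'

/-- The integral operator `(K x)(s) = ∫ k(s,t) x(t) dμ(t)` on `L²(μ)` with kernel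
`k ∈ L²(μ ⊗ μ)`, as a bounded linear operator. -/
def integralOperator (k : ℝ × ℝ → 𝕜) (hk : MemLp k 2 (μ.prod μ)) : Lp 𝕜 2 μ →L[𝕜] Lp 𝕜 2 μ :=
  LinearMap.mkContinuous
    { toFun := fun x => (integralOperator_memLp hk (Lp.memLp x)).toLp _
      map_add' := fun x y => by
        rw [← MemLp.toLp_add]
        refine MemLp.toLp_congr _ _ ?_
        filter_upwards [kernel_sections hk] with s hs
        have h1 : Integrable (fun t => k (s, t) * x t) μ := hs.integrable_mul (Lp.memLp x)
        have h2 : Integrable (fun t => k (s, t) * y t) μ := hs.integrable_mul (Lp.memLp y)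
        rw [Pi.add_apply, ← integral_add h1 h2]
        refine integral_congr_ae ?_
        filter_upwards [Lp.coeFn_add x y] with t ht
        rw [ht, Pi.add_apply, mul_add]
      map_smul' := fun c x => by
        rw [RingHom.id_apply, ← MemLp.toLp_const_smul]
        refine MemLp.toLp_congr _ _ (Filter.Eventually.of_forall fun s => ?_)
        rw [Pi.smul_apply, ← integral_smul]
        refine integral_congr_ae ?_
        filter_upwards [Lp.coeFn_smul c x] with t ht
        rw [ht, Pi.smul_apply, smul_eq_mul, smul_eq_mul, mul_left_comm] }
    (eLpNorm k 2 (μ.prod μ)).toReal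
    (fun x => by
      rw [LinearMap.coe_mk, AddHom.coe_mk, Lp.norm_toLp, Lp.norm_def, ← ENNReal.toReal_mul]
      exact ENNReal.toReal_mono (ENNReal.mul_ne_top hk.2.ne (Lp.memLp x).2.ne)
        (integralOperator_bound hk (Lp.memLp x)))

theorem integralOperator_coeFn (k : ℝ × ℝ → 𝕜) (hk : MemLp k 2 (μ.prod μ)) (x : Lp 𝕜 2 μ) :
    integralOperator k hk x =ᵐ[μ] fun s => ∫ t, k (s, t) * x t ∂μ :=
  MemLp.coeFn_toLp (integralOperator_memLp hk (Lp.memLp x))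

end IntegralOperator

section Sobolev

variable {𝕜 : Type*} [RCLike 𝕜] {a b : ℝ}

/-- `v` is the `i`-th weak derivative of `u` on `(a, b)`: for every test function
`φ ∈ C_c^∞(a, b)`, `∫ φ⁽ⁱ⁾ u = (-1)ⁱ ∫ φ v`. -/
def IsWeakDeriv (i : ℕ) (u v : L2 𝕜 a b) : Prop :=
  ∀ φ : ℝ → ℝ, ContDiff ℝ ∞ φ → HasCompactSupport φ → tsupport φ ⊆ Set.Ioo a b →
    ∫ s in Set.Ioo a b, iteratedDeriv i φ s • u s =
      (-1 : ℝ) ^ i • ∫ s in Set.Ioo a b, φ s • v s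

/-- Membership in the Sobolev space `H^m(a, b)`: the function and its weak derivatives of all
orders up to `m` are in `L²(a, b)`. -/
def MemHm (m : ℕ) (u : L2 𝕜 a b) : Prop :=
  ∀ i ≤ m, ∃ v : L2 𝕜 a b, IsWeakDeriv i u v

end Sobolev

section SingularValues

variable {𝕜 : Type*} [RCLike 𝕜] {E F : Type*}
  [NormedAddCommGroup E] [InnerProductSpace 𝕜 E] [CompleteSpace E]
  [NormedAddCommGroup F] [InnerProductSpace 𝕜 F] [CompleteSpace F]

/-- The sum of the eigenspaces of `T* T` for all its eigenvalues `τ²` with `τ ≥ σ`. For `σ > 0`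
the eigenspaces are independent, so its dimension is the number of singular values of `T` in
`[σ, ∞)`, counted with multiplicity. -/
def singularSubspace (T : E →L[𝕜] F) (σ : ℝ) : Submodule 𝕜 E :=
  ⨆ τ : Set.Ici σ, Module.End.eigenspace
    ((ContinuousLinearMap.adjoint T ∘L T : E →L[𝕜] E) : Module.End 𝕜 E) (((τ : ℝ) ^ 2 : ℝ) : 𝕜)

/-- The `j`-th singular value `s_j(T)`, `j = 1, 2, …`, of a compact operator `T`: the `j`-th
largest of the square roots of the positive eigenvalues of `T* T`, repeated according to
multiplicity, that is, the largest `σ > 0` such that at least `j` of them are `≥ σ`. If there are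
fewer than `j` of them, then the set below is empty and `s_j(T) = 0`. -/
def singularValue (T : E →L[𝕜] F) (j : ℕ) : ℝ :=
  sSup {σ : ℝ | 0 < σ ∧ (j : Cardinal) ≤ Module.rank 𝕜 (singularSubspace T σ)}

/-- For `j ≥ 1` the supremum in `singularValue` is that of a bounded set. -/
theorem singularValue_bddAbove (T : E →L[𝕜] F) {j : ℕ} (hj : 1 ≤ j) :
    BddAbove {σ : ℝ | 0 < σ ∧ (j : Cardinal) ≤ Module.rank 𝕜 (singularSubspace T σ)} := by
  refine ⟨‖T‖, fun σ hσ => ?_⟩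
  obtain ⟨h0, hr⟩ := hσ
  by_contra! hlt
  have hbot : singularSubspace T σ = ⊥ := by
    rw [singularSubspace, iSup_eq_bot]
    rintro ⟨τ, hτ⟩
    rw [Set.mem_Ici] at hτ
    rw [eq_bot_iff]
    intro v hv
    rw [Module.End.mem_eigenspace_iff] at hv
    have hv' : (ContinuousLinearMap.adjoint T) (T v) = ((τ ^ 2 : ℝ) : 𝕜) • v := hv
    have hn : ‖T v‖ ^ 2 = τ ^ 2 * ‖v‖ ^ 2 := by
      have h1 : inner 𝕜 v ((ContinuousLinearMap.adjoint T) (T v)) = inner 𝕜 (T v) (T v) :=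
        ContinuousLinearMap.adjoint_inner_right T v (T v)
      rw [hv', inner_smul_right, inner_self_eq_norm_sq_to_K, inner_self_eq_norm_sq_to_K] at h1
      exact_mod_cast h1.symm
    have hle := T.le_opNorm v
    by_contra hne
    have hpos : 0 < ‖v‖ := norm_pos_iff.mpr hne
    have : ‖T v‖ ^ 2 < τ ^ 2 * ‖v‖ ^ 2 := by
      rw [← mul_pow]
      refine pow_lt_pow_left₀ (hle.trans_lt ?_) (norm_nonneg _) two_ne_zero
      exact mul_lt_mul_of_pos_right (hlt.trans_le hτ) hpos
    exact this.ne hn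
  rw [hbot, rank_bot] at hr
  have : j = 0 := by simpa using hr
  omega

end SingularValues

end

/-! ### Weak derivatives in one variable and the Poincaré inequality -/

section WeakDerivativePrimitive

variable {E : Type*} [NormedAddCommGroup E] [NormedSpace ℝ E] {a b : ℝ}

/-! A singular value `s_j` is at most `c` once the operator is bounded by `c` on a subspace cut out
by fewer than `j` linear conditions (`singularValue_le_of_codim`). Smoothness of the range supplies
such subspaces.

Cut `(a, b)` into `n` equal cells. A function with vanishing mean over every cell satisfies `‖u‖ ≤
(b - a) / n * ‖u'‖`, by Poincaré on each cell. Requiring this of `K x` and of its weak derivatives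
of orders below `m` costs `m * n` conditions on `x` and, by iteration, gives `‖K x‖ ≤ ((b - a) / n)
^ m * ‖(K x)⁽ᵐ⁾‖`. By the closed graph theorem `x ↦ (K x)⁽ᵐ⁾` is bounded, so `s_j = O(n⁻ᵐ)` with `n`
about `j / m`. Of `K` only boundedness and the range condition are used, not the form of the kernel.

Poincaré rests on the du Bois-Reymond lemma: a function with an integrable weak derivative is almost
everywhere a constant plus a primitive of it. -/

theorem integral_deriv_smul_primitive [CompleteSpace E] {g : ℝ → E}
    (hg : IntegrableOn g (Set.Ioo a b))
    {φ : ℝ → ℝ} (hφ : ContDiff ℝ ∞ φ) (hs : tsupport φ ⊆ Set.Ioo a b) :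
    ∫ s in Set.Ioo a b, deriv φ s • (∫ t in Set.Ioo a s, g t) =
      -∫ t in Set.Ioo a b, φ t • g t := by
  have hφ' : Continuous (deriv φ) := hφ.continuous_deriv (by simp)
  have hφi : IntegrableOn (deriv φ) (Set.Ioo a b) :=
    (hφ'.integrableOn_Icc (a := a) (b := b)).mono_set Set.Ioo_subset_Icc_self
  have hb : φ b = 0 := image_eq_zero_of_notMem_tsupport fun h => (hs h).2.false
  -- Write the double integral over the triangle `t < s`; after Fubini the inner integral is `∫ₜᵇ φ'
  -- = -φ t`.
  have h1 : ∫ s in Set.Ioo a b, deriv φ s • (∫ t in Set.Ioo a s, g t) =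
      ∫ s in Set.Ioo a b, ∫ t in Set.Ioo a b,
        {p : ℝ × ℝ | p.2 < p.1}.indicator (fun p => deriv φ p.1 • g p.2) (s, t) := by
    refine setIntegral_congr_fun measurableSet_Ioo fun s hs => ?_
    rw [← integral_smul, ← integral_indicator measurableSet_Ioo,
      ← integral_indicator measurableSet_Ioo]
    congr 1
    ext t
    simp only [Set.indicator, Set.mem_Ioo, Set.mem_ofPred_eq]
    have := hs.2
    by_cases h1 : a < t <;> by_cases h2 : t < s
    · simp [h1, h2, h2.trans this]
    · simp [h2]
    · simp [h1]
    · simp [h1]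
  rw [h1, integral_integral_swap, ← integral_neg]
  · refine setIntegral_congr_fun measurableSet_Ioo fun t ht => ?_
    have h2 : ∀ s, {p : ℝ × ℝ | p.2 < p.1}.indicator (fun p => deriv φ p.1 • g p.2) (s, t) =
        (Set.Ioi t).indicator (fun s => deriv φ s) s • g t := by
      intro s
      by_cases h : t < s <;> simp [Set.indicator, h]
    simp only [h2]
    rw [integral_smul_const, setIntegral_indicator measurableSet_Ioi]
    have h3 : Set.Ioo a b ∩ Set.Ioi t = Set.Ioo t b := by
      ext s
      simp only [Set.mem_inter_iff, Set.mem_Ioo, Set.mem_Ioi]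
      exact ⟨fun h => ⟨h.2, h.1.2⟩, fun h => ⟨⟨ht.1.trans h.1, h.2⟩, h.1⟩⟩
    rw [h3, ← integral_Ioc_eq_integral_Ioo, ← intervalIntegral.integral_of_le ht.2.le,
      intervalIntegral.integral_deriv_eq_sub (fun x _ => hφ.differentiable (by simp) x)
        (hφ'.intervalIntegrable _ _), hb, zero_sub, neg_smul]
  · exact (hφi.smul_prod hg).indicator (measurableSet_lt measurable_snd measurable_fst)

/-- The primitive from `α` vanishes to the left of `α` because `η` does, and to the right of `β`
because the total integral is zero. -/
theorem exists_contDiff_deriv_eq {η : ℝ → ℝ} (hη : ContDiff ℝ ∞ η) {α β : ℝ}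
    (hs : Function.support η ⊆ Set.Icc α β) (h0 : ∫ t, η t = 0) :
    ∃ φ : ℝ → ℝ, ContDiff ℝ ∞ φ ∧ tsupport φ ⊆ Set.Icc α β ∧ deriv φ = η := by
  have hd : deriv (fun x => ∫ t in α..x, η t) = η :=
    funext fun x => hη.continuous.deriv_integral η α x
  refine ⟨fun x => ∫ t in α..x, η t, ?_, ?_, hd⟩
  · rw [contDiff_infty_iff_deriv, hd]
    exact ⟨fun x => (hη.continuous.integral_hasStrictDerivAt α x).hasDerivAt.differentiableAt, hη⟩
  · refine closure_minimal (fun x hx => ?_) isClosed_Icc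
    by_contra hxI
    refine hx ?_
    have hz : ∀ t, t ∉ Set.Icc α β → η t = 0 := fun t ht => by
      by_contra h
      exact ht (hs h)
    by_cases hxα : x < α
    · simp only
      rw [intervalIntegral.integral_symm, intervalIntegral.integral_of_le hxα.le,
        integral_Ioc_eq_integral_Ioo, setIntegral_eq_zero_of_forall_eq_zero, neg_zero]
      exact fun t ht => hz t fun h => (ht.2.trans_le h.1).false
    · have hxβ : β < x := by
        by_contra h
        exact hxI ⟨not_lt.1 hxα, not_lt.1 h⟩
      simp only
      rw [intervalIntegral.integral_of_le (not_lt.1 hxα), ← integral_Icc_eq_integral_Ioc,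
        setIntegral_eq_integral_of_forall_compl_eq_zero, h0]
      exact fun t ht => hz t fun h => ht ⟨h.1, h.2.trans hxβ.le⟩

/-- The du Bois-Reymond lemma. -/
theorem ae_eq_const_of_integral_deriv_smul_eq_zero [CompleteSpace E] (hab : a < b) {f : ℝ → E}
    (hf : IntegrableOn f (Set.Ioo a b))
    (h : ∀ φ : ℝ → ℝ, ContDiff ℝ ∞ φ → HasCompactSupport φ → tsupport φ ⊆ Set.Ioo a b →
      ∫ s in Set.Ioo a b, deriv φ s • f s = 0) :
    ∃ c : E, ∀ᵐ s ∂volume.restrict (Set.Ioo a b), f s = c := by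
  obtain ⟨ρ, hρ, hρc, hρs, hρ1⟩ : ∃ ρ : ℝ → ℝ, ContDiff ℝ ∞ ρ ∧ HasCompactSupport ρ ∧
      tsupport ρ ⊆ Set.Ioo a b ∧ ∫ t, ρ t = 1 := by
    let B : ContDiffBump ((a + b) / 2) :=
      ⟨(b - a) / 8, (b - a) / 4, by linarith, by linarith⟩
    refine ⟨B.normed volume, B.contDiff_normed, B.hasCompactSupport_normed, ?_, B.integral_normed⟩
    rw [B.tsupport_normed_eq, Real.closedBall_eq_Icc]
    change Set.Icc ((a + b) / 2 - (b - a) / 4) ((a + b) / 2 + (b - a) / 4) ⊆ _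
    exact fun t ht => ⟨by linarith [ht.1], by linarith [ht.2]⟩
  have hint : ∀ ψ : ℝ → ℝ, Continuous ψ → HasCompactSupport ψ →
      IntegrableOn (fun s => ψ s • f s) (Set.Ioo a b) := fun ψ hψ hψc => by
    obtain ⟨M, hM⟩ := hψc.exists_bound_of_continuous hψ
    exact hf.bdd_smul M hψ.aestronglyMeasurable (Filter.Eventually.of_forall hM)
  refine ⟨∫ s in Set.Ioo a b, ρ s • f s, ?_⟩
  set c := ∫ s in Set.Ioo a b, ρ s • f s
  have key := isOpen_Ioo.ae_eq_zero_of_integral_contDiff_smul_eq_zero (U := Set.Ioo a b)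
    (μ := volume.restrict (Set.Ioo a b)) (f := fun s => f s - c)
    ((hf.sub (integrable_const c)).locallyIntegrable.locallyIntegrableOn _) ?_
  · filter_upwards [key, ae_restrict_mem measurableSet_Ioo] with s h1 h2
    exact sub_eq_zero.1 (h1 h2)
  intro ψ hψ hψc hψs
  obtain ⟨α, β, hα, hαβ, hβ, hK⟩ : ∃ α β, a < α ∧ α ≤ β ∧ β < b ∧
      tsupport ψ ∪ tsupport ρ ⊆ Set.Icc α β := by
    have hKc : IsCompact (tsupport ψ ∪ tsupport ρ) := hψc.isCompact.union hρc.isCompact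
    have hKs : tsupport ψ ∪ tsupport ρ ⊆ Set.Ioo a b := Set.union_subset hψs hρs
    have hne : (tsupport ψ ∪ tsupport ρ).Nonempty := by
      by_contra hne
      rw [Set.not_nonempty_iff_eq_empty, Set.union_empty_iff] at hne
      rw [tsupport_eq_empty_iff.1 hne.2] at hρ1
      simp at hρ1
    obtain ⟨α, hα⟩ := hKc.exists_isLeast hne
    obtain ⟨β, hβ⟩ := hKc.exists_isGreatest hne
    exact ⟨α, β, (hKs hα.1).1, hα.2 hβ.1, (hKs hβ.1).2, fun t ht => ⟨hα.2 ht, hβ.2 ht⟩⟩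
  have hρi : Integrable ρ := hρ.continuous.integrable_of_hasCompactSupport hρc
  have hψi : Integrable ψ := hψ.continuous.integrable_of_hasCompactSupport hψc
  -- Subtracting the right multiple of `ρ` makes `ψ` mean-zero, hence a derivative of a test
  -- function. Testing with it yields `∫ ψ f = (∫ ψ) c`.
  obtain ⟨φ, hφ, hφs, hφd⟩ := exists_contDiff_deriv_eq
    (η := fun t => ψ t - (∫ t, ψ t) * ρ t) (hψ.sub (contDiff_const.mul hρ))
    (fun t ht => by
      refine hK ?_
      by_contra hn
      simp only [Set.mem_union, not_or] at hn
      exact ht (by simp [image_eq_zero_of_notMem_tsupport hn.1,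
        image_eq_zero_of_notMem_tsupport hn.2]))
    (by rw [integral_sub hψi (hρi.const_mul _), integral_const_mul, hρ1]; simp)
  have h0 := h φ hφ (isCompact_Icc.of_isClosed_subset (isClosed_tsupport φ) hφs)
    (hφs.trans fun t ht => ⟨hα.trans_le ht.1, ht.2.trans_lt hβ⟩)
  rw [hφd] at h0
  simp only [sub_smul, mul_smul] at h0
  have hρf : IntegrableOn (fun s => (∫ t, ψ t) • ρ s • f s) (Set.Ioo a b) :=
    (hint ρ hρ.continuous hρc).smul _
  rw [integral_sub (hint ψ hψ.continuous hψc) hρf, integral_smul] at h0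
  simp only [smul_sub]
  rw [integral_sub (hint ψ hψ.continuous hψc) (hψi.integrableOn.smul_const c),
    integral_smul_const, setIntegral_eq_integral_of_forall_compl_eq_zero (f := ψ), h0]
  exact fun t ht => image_eq_zero_of_notMem_tsupport fun h => ht (hψs h)

/-- The difference of `f` and the primitive of `g` has weak derivative zero, so du Bois-Reymond
applies. -/
theorem exists_ae_eq_add_primitive [CompleteSpace E] (hab : a < b) {f g : ℝ → E}
    (hf : IntegrableOn f (Set.Ioo a b)) (hg : IntegrableOn g (Set.Ioo a b))
    (h : ∀ φ : ℝ → ℝ, ContDiff ℝ ∞ φ → HasCompactSupport φ → tsupport φ ⊆ Set.Ioo a b →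
      ∫ s in Set.Ioo a b, deriv φ s • f s = -∫ s in Set.Ioo a b, φ s • g s) :
    ∃ c : E, ∀ᵐ s ∂volume.restrict (Set.Ioo a b), f s = c + ∫ t in Set.Ioo a s, g t := by
  have hG : IntegrableOn (fun s => ∫ t in Set.Ioo a s, g t) (Set.Ioo a b) := by
    have hg' : IntegrableOn g (Set.uIcc a b) := by
      rwa [Set.uIcc_of_le hab.le, integrableOn_Icc_iff_integrableOn_Ioo]
    have hc := intervalIntegral.continuousOn_primitive_interval hg'
    rw [Set.uIcc_of_le hab.le] at hc
    refine (((hc.integrableOn_Icc (μ := volume)).mono_set Set.Ioo_subset_Icc_self)).congr_fun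
      (fun s hs => ?_) measurableSet_Ioo
    simp only
    rw [intervalIntegral.integral_of_le hs.1.le, integral_Ioc_eq_integral_Ioo]
  have hbd : ∀ {ψ : ℝ → ℝ} {F : ℝ → E}, Continuous ψ → HasCompactSupport ψ →
      IntegrableOn F (Set.Ioo a b) → IntegrableOn (fun s => ψ s • F s) (Set.Ioo a b) :=
    fun {ψ F} hψ hψc hF => by
      obtain ⟨M, hM⟩ := hψc.exists_bound_of_continuous hψ
      exact hF.bdd_smul M hψ.aestronglyMeasurable (Filter.Eventually.of_forall hM)
  obtain ⟨c, hc⟩ := ae_eq_const_of_integral_deriv_smul_eq_zero hab (hf.sub hG) fun φ hφ hφc hφs => by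
    have hd : Continuous (deriv φ) := hφ.continuous_deriv (by simp)
    simp only [Pi.sub_apply, smul_sub]
    rw [integral_sub (hbd hd hφc.deriv hf) (hbd hd hφc.deriv hG), h φ hφ hφc hφs,
      integral_deriv_smul_primitive hg hφ hφs, sub_self]
  exact ⟨c, hc.mono fun s hs => sub_eq_iff_eq_add.1 hs⟩

theorem sq_setIntegral_norm_le {E : Type*} [NormedAddCommGroup E] {g : ℝ → E} {p q : ℝ} (hpq : p < q)
    (hg : MemLp g 2 (volume.restrict (Set.Ioo p q))) :
    (∫ t in Set.Ioo p q, ‖g t‖) ^ 2 ≤ (q - p) * ∫ t in Set.Ioo p q, ‖g t‖ ^ 2 := by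
  set A := ∫ t in Set.Ioo p q, ‖g t‖
  have h1 : Integrable (fun t => ‖g t‖) (volume.restrict (Set.Ioo p q)) :=
    (hg.integrable (by norm_num)).norm
  have h2 : Integrable (fun t => ‖g t‖ ^ 2) (volume.restrict (Set.Ioo p q)) :=
    hg.integrable_norm_pow (by norm_num)
  have hpos : 0 < q - p := sub_pos.2 hpq
  -- Cauchy–Schwarz against the constant 1, read off from the nonnegative variance of `‖g‖`.
  have h0 : 0 ≤ ∫ t in Set.Ioo p q, ((q - p) * ‖g t‖ - A) ^ 2 :=
    integral_nonneg fun t => sq_nonneg _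
  have h3 : ∫ t in Set.Ioo p q, ((q - p) * ‖g t‖ - A) ^ 2 =
      (q - p) * ((q - p) * (∫ t in Set.Ioo p q, ‖g t‖ ^ 2) - A ^ 2) := by
    have : ∀ t, ((q - p) * ‖g t‖ - A) ^ 2 =
        (q - p) ^ 2 * ‖g t‖ ^ 2 - (2 * (q - p) * A) * ‖g t‖ + A ^ 2 := fun t => by ring
    simp only [this]
    have h4 : Integrable (fun t => (q - p) ^ 2 * ‖g t‖ ^ 2 - (2 * (q - p) * A) * ‖g t‖)
        (volume.restrict (Set.Ioo p q)) := (h2.const_mul _).sub (h1.const_mul _)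
    rw [integral_add h4 (integrable_const _), integral_sub (h2.const_mul _) (h1.const_mul _), integral_const_mul, integral_const_mul,
      setIntegral_const, measureReal_def, Real.volume_Ioo, ENNReal.toReal_ofReal hpos.le,
      smul_eq_mul]
    change _ - _ * A + _ = _
    ring
  rw [h3] at h0
  exact sub_nonneg.1 (nonneg_of_mul_nonneg_right h0 hpos)

/-- The Poincaré inequality on a subinterval on which `f` has mean zero. -/
theorem setIntegral_norm_sq_le_of_integral_eq_zero [CompleteSpace E] {f g : ℝ → E} {c : E}
    (hg : MemLp g 2 (volume.restrict (Set.Ioo a b)))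
    (hfg : ∀ᵐ s ∂volume.restrict (Set.Ioo a b), f s = c + ∫ t in Set.Ioo a s, g t)
    {p q : ℝ} (hap : a ≤ p) (hpq : p < q) (hqb : q ≤ b)
    (hf : IntegrableOn f (Set.Ioo p q)) (h0 : ∫ s in Set.Ioo p q, f s = 0) :
    ∫ s in Set.Ioo p q, ‖f s‖ ^ 2 ≤ (q - p) ^ 2 * ∫ s in Set.Ioo p q, ‖g s‖ ^ 2 := by
  have hsub : Set.Ioo p q ⊆ Set.Ioo a b := Set.Ioo_subset_Ioo hap hqb
  have hpos : 0 < q - p := sub_pos.2 hpq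
  have hvol : volume.real (Set.Ioo p q) = q - p := by
    rw [measureReal_def, Real.volume_Ioo, ENNReal.toReal_ofReal hpos.le]
  have hgI : MemLp g 2 (volume.restrict (Set.Ioo p q)) :=
    hg.mono_measure (Measure.restrict_mono hsub le_rfl)
  have hgi : IntegrableOn g (Set.Ioo a b) := hg.integrable (by norm_num)
  set A := ∫ t in Set.Ioo p q, ‖g t‖ with hA
  have hfg' : ∀ᵐ s ∂volume.restrict (Set.Ioo p q), f s = c + ∫ t in Set.Ioo a s, g t :=
    ae_restrict_of_ae_restrict_of_subset hsub hfg
  have hii : ∀ s ∈ Set.Ioo p q, IntervalIntegrable g volume a s := fun s hs => by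
    rw [intervalIntegrable_iff_integrableOn_Ioo_of_le (hap.trans hs.1.le)]
    exact hgi.mono_set (Set.Ioo_subset_Ioo_right (hs.2.le.trans hqb))
  have hdiff : ∀ s ∈ Set.Ioo p q, ∀ t ∈ Set.Ioo p q,
      ‖(∫ r in Set.Ioo a s, g r) - ∫ r in Set.Ioo a t, g r‖ ≤ A := fun s hs t ht => by
    rw [← integral_Ioc_eq_integral_Ioo, ← integral_Ioc_eq_integral_Ioo,
      ← intervalIntegral.integral_of_le (hap.trans hs.1.le),
      ← intervalIntegral.integral_of_le (hap.trans ht.1.le),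
      intervalIntegral.integral_interval_sub_left (hii s hs) (hii t ht)]
    refine intervalIntegral.norm_integral_le_integral_norm_uIoc.trans ?_
    refine setIntegral_mono_set (hgI.integrable (by norm_num)).norm
      (Filter.Eventually.of_forall fun _ => norm_nonneg _) (LE.le.eventuallyLE ?_)
    intro r hr
    rw [Set.mem_uIoc] at hr
    rcases hr with hr | hr
    · exact ⟨ht.1.trans hr.1, hr.2.trans_lt hs.2⟩
    · exact ⟨hs.1.trans hr.1, hr.2.trans_lt ht.2⟩
  -- With mean zero, `f s` is the average over `t` of `f s - f t`, and the oscillation of `f` is at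
  -- most `A`.
  have hsup : ∀ᵐ s ∂volume.restrict (Set.Ioo p q), ‖f s‖ ≤ A := by
    filter_upwards [hfg', ae_restrict_mem measurableSet_Ioo] with s hs hsI
    have h1 : ∫ t in Set.Ioo p q, (f s - f t) = (q - p) • f s := by
      rw [integral_sub (integrable_const _) hf, h0, sub_zero, setIntegral_const, hvol]
    have h2 : ‖∫ t in Set.Ioo p q, (f s - f t)‖ ≤ A * volume.real (Set.Ioo p q) := by
      refine norm_setIntegral_le_of_norm_le_const_ae measure_Ioo_lt_top ?_
      filter_upwards [hfg', ae_restrict_mem measurableSet_Ioo] with t ht htI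
      rw [hs, ht, add_sub_add_left_eq_sub]
      exact hdiff s hsI t htI
    rw [h1, norm_smul, Real.norm_of_nonneg hpos.le, hvol, mul_comm] at h2
    exact le_of_mul_le_mul_right h2 hpos
  calc ∫ s in Set.Ioo p q, ‖f s‖ ^ 2 ≤ ∫ s in Set.Ioo p q, A ^ 2 := by
        refine integral_mono_of_nonneg (Filter.Eventually.of_forall fun _ => sq_nonneg _)
          (integrable_const _) ?_
        filter_upwards [hsup] with s hs
        exact pow_le_pow_left₀ (norm_nonneg _) hs 2
    _ = (q - p) * A ^ 2 := by rw [setIntegral_const, hvol, smul_eq_mul]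
    _ ≤ (q - p) * ((q - p) * ∫ s in Set.Ioo p q, ‖g s‖ ^ 2) := by
        gcongr
        exact sq_setIntegral_norm_le hpq hgI
    _ = _ := by ring

theorem sum_setIntegral_uniform_partition {F : ℝ → E} (hF : IntegrableOn F (Set.Ioo a b))
    (hab : a < b) {n : ℕ} (hn : 0 < n) :
    ∑ k ∈ Finset.range n, ∫ s in Set.Ioo (a + k * ((b - a) / n)) (a + (k + 1 : ℕ) * ((b - a) / n)),
      F s = ∫ s in Set.Ioo a b, F s := by
  have hn' : (0 : ℝ) < n := Nat.cast_pos.2 hn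
  have hh : 0 < (b - a) / n := div_pos (sub_pos.2 hab) hn'
  have hnh : a + n * ((b - a) / n) = b := by field_simp; ring
  have hmono : Monotone fun k : ℕ => a + k * ((b - a) / n) := fun i j hij => by
    have : (i : ℝ) ≤ j := Nat.cast_le.2 hij
    simp only
    gcongr
  have hconv : ∀ p q : ℝ, p ≤ q → ∫ s in Set.Ioo p q, F s = ∫ s in p..q, F s := fun p q h => by
    rw [← integral_Ioc_eq_integral_Ioo, intervalIntegral.integral_of_le h]
  have := intervalIntegral.sum_integral_adjacent_intervals (f := F) (μ := volume)
    (a := fun k : ℕ => a + k * ((b - a) / n)) (n := n) fun k hk => by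
      have h1 := hmono (Nat.zero_le k)
      have h2 := hmono (Nat.succ_le_of_lt hk)
      simp only [Nat.cast_zero, zero_mul, add_zero, hnh] at h1 h2
      rw [intervalIntegrable_iff_integrableOn_Ioo_of_le (hmono k.le_succ)]
      exact hF.mono_set (Set.Ioo_subset_Ioo h1 h2)
  simp only [Nat.cast_zero, zero_mul, add_zero, hnh] at this
  rw [hconv a b hab.le, ← this]
  exact Finset.sum_congr rfl fun k _ => hconv _ _ (hmono k.le_succ)

theorem uniform_partition_cell_bounds (hab : a < b) {n k : ℕ} (hk : k < n) :
    a ≤ a + k * ((b - a) / n) ∧ a + (k + 1 : ℕ) * ((b - a) / n) ≤ b := by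
  have hn' : (0 : ℝ) < n := Nat.cast_pos.2 (Nat.zero_lt_of_lt hk)
  have hh : 0 < (b - a) / n := div_pos (sub_pos.2 hab) hn'
  have hnh : a + n * ((b - a) / n) = b := by field_simp; ring
  have h1 : 0 ≤ k * ((b - a) / n) := by positivity
  have h2 : ((k + 1 : ℕ) : ℝ) ≤ n := Nat.cast_le.2 hk
  exact ⟨by linarith, by nlinarith⟩

end WeakDerivativePrimitive

/-! ### Weak derivatives of a bounded operator -/

section WeakDerivativeOperator

variable {𝕜 : Type*} [RCLike 𝕜] {a b : ℝ}

/-- Pairings with test functions become inner products in `L²`, so linearity and passage to limits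
come from the Hilbert space. -/
theorem exists_inner_eq_setIntegral_smul {ψ : ℝ → ℝ} (hψ : Continuous ψ)
    (hc : HasCompactSupport ψ) :
    ∃ p : L2 𝕜 a b, ∀ u : L2 𝕜 a b, ∫ s in Set.Ioo a b, ψ s • u s = inner 𝕜 p u := by
  have hψ' : Continuous fun s => (ψ s : 𝕜) := RCLike.continuous_ofReal.comp hψ
  have hm : MemLp (fun s => (ψ s : 𝕜)) 2 (intervalMeasure a b) := by
    obtain ⟨M, hM⟩ := hc.exists_bound_of_continuous hψ
    refine MemLp.of_bound hψ'.aestronglyMeasurable M (Filter.Eventually.of_forall fun s => ?_)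
    rw [RCLike.norm_ofReal]
    exact hM s
  refine ⟨hm.toLp _, fun u => ?_⟩
  rw [L2.inner_def]
  refine integral_congr_ae ?_
  filter_upwards [hm.coeFn_toLp] with s hs
  rw [hs, RCLike.inner_apply, RCLike.conj_ofReal, mul_comm, RCLike.real_smul_eq_coe_mul]

theorem IsWeakDeriv.unique {i : ℕ} {u v w : L2 𝕜 a b} (hv : IsWeakDeriv i u v)
    (hw : IsWeakDeriv i u w) : v = w := by
  have hi : Integrable (v - w : L2 𝕜 a b) (intervalMeasure a b) :=
    (Lp.memLp (v - w)).integrable (by norm_num)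
  have key := isOpen_Ioo.ae_eq_zero_of_integral_contDiff_smul_eq_zero (U := Set.Ioo a b)
    (μ := volume.restrict (Set.Ioo a b)) (f := (v - w : L2 𝕜 a b))
    (hi.locallyIntegrable.locallyIntegrableOn _) fun φ hφ hc hs => by
      obtain ⟨p, hp⟩ := exists_inner_eq_setIntegral_smul (𝕜 := 𝕜) (a := a) (b := b)
        hφ.continuous hc
      have h := (hv φ hφ hc hs).symm.trans (hw φ hφ hc hs)
      have h' := smul_right_injective 𝕜 (pow_ne_zero i (by norm_num : (-1 : ℝ) ≠ 0)) h
      rw [hp, inner_sub_right, ← hp, ← hp]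
      exact sub_eq_zero.2 h'
  refine sub_eq_zero.1 ((Lp.eq_zero_iff_ae_eq_zero).2 ?_)
  filter_upwards [key, ae_restrict_mem measurableSet_Ioo] with s h1 h2
  exact h1 h2

theorem isWeakDeriv_iff_inner {i : ℕ} {φ : ℝ → ℝ} (hφ : ContDiff ℝ ∞ φ)
    (hc : HasCompactSupport φ) :
    ∃ p q : L2 𝕜 a b, ∀ u v : L2 𝕜 a b,
      (∫ s in Set.Ioo a b, iteratedDeriv i φ s • u s =
        (-1 : ℝ) ^ i • ∫ s in Set.Ioo a b, φ s • v s) ↔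
      inner 𝕜 p u = (-1 : ℝ) ^ i • inner 𝕜 q v := by
  have hci : HasCompactSupport (iteratedDeriv i φ) := by
    rw [iteratedDeriv_eq_iterate]
    clear hφ
    induction i with
    | zero => exact hc
    | succ i ih =>
      rw [Function.iterate_succ_apply']
      exact ih.deriv
  obtain ⟨p, hp⟩ := exists_inner_eq_setIntegral_smul (𝕜 := 𝕜) (a := a) (b := b)
    (hφ.continuous_iteratedDeriv i (by exact_mod_cast le_top)) hci
  obtain ⟨q, hq⟩ := exists_inner_eq_setIntegral_smul (𝕜 := 𝕜) (a := a) (b := b)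
    hφ.continuous hc
  exact ⟨p, q, fun u v => by rw [hp, hq]⟩

theorem IsWeakDeriv.add {i : ℕ} {u v u' v' : L2 𝕜 a b} (h : IsWeakDeriv i u v)
    (h' : IsWeakDeriv i u' v') : IsWeakDeriv i (u + u') (v + v') := fun φ hφ hc hs => by
  obtain ⟨p, q, hpq⟩ := isWeakDeriv_iff_inner (𝕜 := 𝕜) (a := a) (b := b) (i := i) hφ hc
  rw [hpq, inner_add_right, inner_add_right, smul_add, (hpq u v).1 (h φ hφ hc hs),
    (hpq u' v').1 (h' φ hφ hc hs)]

theorem IsWeakDeriv.const_smul {i : ℕ} {u v : L2 𝕜 a b} (h : IsWeakDeriv i u v) (c : 𝕜) :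
    IsWeakDeriv i (c • u) (c • v) := fun φ hφ hc hs => by
  obtain ⟨p, q, hpq⟩ := isWeakDeriv_iff_inner (𝕜 := 𝕜) (a := a) (b := b) (i := i) hφ hc
  rw [hpq, inner_smul_right, inner_smul_right, (hpq u v).1 (h φ hφ hc hs), mul_smul_comm]

theorem IsWeakDeriv.of_tendsto {i : ℕ} {u v : ℕ → L2 𝕜 a b} {u' v' : L2 𝕜 a b}
    (h : ∀ n, IsWeakDeriv i (u n) (v n)) (hu : Filter.Tendsto u Filter.atTop (nhds u'))
    (hv : Filter.Tendsto v Filter.atTop (nhds v')) : IsWeakDeriv i u' v' := fun φ hφ hc hs => by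
  obtain ⟨p, q, hpq⟩ := isWeakDeriv_iff_inner (𝕜 := 𝕜) (a := a) (b := b) (i := i) hφ hc
  rw [hpq]
  have h1 : Filter.Tendsto (fun n => inner 𝕜 p (u n)) Filter.atTop (nhds (inner 𝕜 p u')) :=
    tendsto_const_nhds.inner hu
  have h2 : Filter.Tendsto (fun n => (-1 : ℝ) ^ i • inner 𝕜 q (v n)) Filter.atTop
      (nhds ((-1 : ℝ) ^ i • inner 𝕜 q v')) := (tendsto_const_nhds.inner hv).const_smul _
  exact tendsto_nhds_unique h1 (h2.congr fun n => ((hpq _ _).1 (h n φ hφ hc hs)).symm)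

theorem IsWeakDeriv.zero (u : L2 𝕜 a b) : IsWeakDeriv 0 u u := fun φ _ _ _ => by simp

/-- The weak derivative of the `i`-th weak derivative is the `(i + 1)`-st one. -/
theorem IsWeakDeriv.one_of_succ {i : ℕ} {u v w : L2 𝕜 a b} (hv : IsWeakDeriv i u v)
    (hw : IsWeakDeriv (i + 1) u w) : IsWeakDeriv 1 v w := fun φ hφ hc hs => by
  have h1 := hv (deriv φ) (contDiff_infty_iff_deriv.1 hφ).2 hc.deriv
    (tsupport_deriv_subset.trans hs)
  have h2 := hw φ hφ hc hs
  rw [iteratedDeriv_succ'] at h2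
  rw [h1, pow_succ, mul_smul] at h2
  rw [iteratedDeriv_one, pow_one]
  exact smul_right_injective 𝕜 (pow_ne_zero i (by norm_num : (-1 : ℝ) ≠ 0)) h2

theorem norm_sq_eq_setIntegral (u : L2 𝕜 a b) :
    ‖u‖ ^ 2 = ∫ s in Set.Ioo a b, ‖u s‖ ^ 2 := by
  have h := inner_self_eq_norm_sq_to_K (𝕜 := 𝕜) u
  have h2 : ∀ s, inner 𝕜 (u s) (u s) = ((‖u s‖ ^ 2 : ℝ) : 𝕜) := fun s => by
    rw [inner_self_eq_norm_sq_to_K]; push_cast; rfl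
  rw [L2.inner_def] at h
  simp only [h2] at h
  rw [integral_ofReal] at h
  exact_mod_cast h.symm

/-- Poincaré inequality for a function whose means over the cells of a uniform partition vanish. -/
theorem IsWeakDeriv.norm_le_of_partition_means_eq_zero (hab : a < b) {u v : L2 𝕜 a b}
    (h : IsWeakDeriv 1 u v) {n : ℕ} (hn : 0 < n)
    (h0 : ∀ k < n, ∫ s in Set.Ioo (a + k * ((b - a) / n)) (a + (k + 1 : ℕ) * ((b - a) / n)),
      u s = 0) :
    ‖u‖ ≤ (b - a) / n * ‖v‖ := by
  have hn' : (0 : ℝ) < n := Nat.cast_pos.2 hn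
  have hh : 0 < (b - a) / n := div_pos (sub_pos.2 hab) hn'
  have hu : IntegrableOn u (Set.Ioo a b) := (Lp.memLp u).integrable (by norm_num)
  have hv : IntegrableOn v (Set.Ioo a b) := (Lp.memLp v).integrable (by norm_num)
  obtain ⟨c, hc⟩ := exists_ae_eq_add_primitive hab hu hv fun φ hφ hφc hφs => by
    have := h φ hφ hφc hφs
    rwa [iteratedDeriv_one, pow_one, neg_one_smul] at this
  refine le_of_sq_le_sq ?_ (by positivity)
  have hu2 : IntegrableOn (fun s => ‖u s‖ ^ 2) (Set.Ioo a b) :=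
    (Lp.memLp u).integrable_norm_pow (by norm_num)
  have hv2 : IntegrableOn (fun s => ‖v s‖ ^ 2) (Set.Ioo a b) :=
    (Lp.memLp v).integrable_norm_pow (by norm_num)
  rw [mul_pow, norm_sq_eq_setIntegral, norm_sq_eq_setIntegral,
    ← sum_setIntegral_uniform_partition hu2 hab hn,
    ← sum_setIntegral_uniform_partition hv2 hab hn, Finset.mul_sum]
  refine Finset.sum_le_sum fun k hk => ?_
  rw [Finset.mem_range] at hk
  have hlen : a + (k + 1 : ℕ) * ((b - a) / n) - (a + k * ((b - a) / n)) = (b - a) / n := by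
    push_cast; ring
  obtain ⟨hap, hqb⟩ := uniform_partition_cell_bounds hab hk
  have := setIntegral_norm_sq_le_of_integral_eq_zero (Lp.memLp v) hc hap (by linarith) hqb
    (hu.mono_set (Set.Ioo_subset_Ioo hap hqb)) (h0 k hk)
  rwa [hlen] at this

/-- Uniqueness of weak derivatives forces any pointwise choice of them to be linear. -/
theorem exists_linearMap_isWeakDeriv {F : Type*} [AddCommGroup F] [Module 𝕜 F] {i : ℕ}
    (T : F →ₗ[𝕜] L2 𝕜 a b) (hT : ∀ x, ∃ v, IsWeakDeriv i (T x) v) :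
    ∃ D : F →ₗ[𝕜] L2 𝕜 a b, ∀ x, IsWeakDeriv i (T x) (D x) := by
  choose D hD using hT
  refine ⟨⟨⟨D, fun x y => ?_⟩, fun c x => ?_⟩, hD⟩
  · have := (hD x).add (hD y)
    rw [← map_add] at this
    exact (hD _).unique this
  · have := (hD x).const_smul c
    rw [← map_smul] at this
    exact (hD _).unique this

/-- By the closed graph theorem, weak derivatives of a bounded operator are bounded. -/
theorem exists_bound_of_isWeakDeriv {F : Type*} [NormedAddCommGroup F] [NormedSpace 𝕜 F]
    [CompleteSpace F] {i : ℕ} (T : F →L[𝕜] L2 𝕜 a b) (D : F →ₗ[𝕜] L2 𝕜 a b)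
    (hD : ∀ x, IsWeakDeriv i (T x) (D x)) : ∃ M, 0 < M ∧ ∀ x, ‖D x‖ ≤ M * ‖x‖ := by
  have hcont : Continuous D := D.continuous_of_seq_closed_graph fun u x y hu hy =>
    (IsWeakDeriv.of_tendsto (fun n => hD (u n)) ((T.continuous.tendsto x).comp hu) hy).unique (hD x)
  exact ContinuousLinearMap.bound ⟨D, hcont⟩

end WeakDerivativeOperator

/-! ### Bounding singular values by codimension -/

section SingularValueBound

variable {𝕜 : Type*} [RCLike 𝕜] {E F : Type*}
  [NormedAddCommGroup E] [InnerProductSpace 𝕜 E] [CompleteSpace E]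
  [NormedAddCommGroup F] [InnerProductSpace 𝕜 F] [CompleteSpace F]

/-- Eigenspaces of `T* T` are orthogonal, so for `v = ∑ v_τ` one has `‖T v‖² = ⟨v, T* T v⟩ = ∑ τ²
‖v_τ‖²` with every `τ ≥ σ`. -/
theorem mul_norm_le_of_mem_singularSubspace (T : E →L[𝕜] F) {σ : ℝ} (hσ : 0 ≤ σ) {v : E}
    (hv : v ∈ singularSubspace T σ) : σ * ‖v‖ ≤ ‖T v‖ := by
  set A : E →L[𝕜] E := ContinuousLinearMap.adjoint T ∘L T with hA
  have hsym : ((A : E →L[𝕜] E) : Module.End 𝕜 E).IsSymmetric := fun x y => by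
    change inner 𝕜 (ContinuousLinearMap.adjoint T (T x)) y =
      inner 𝕜 x (ContinuousLinearMap.adjoint T (T y))
    rw [ContinuousLinearMap.adjoint_inner_left, ContinuousLinearMap.adjoint_inner_right]
  -- Since `σ ≥ 0`, distinct `τ` give distinct eigenvalues `τ²`; otherwise the family would repeat
  -- an eigenspace.
  have hinj : Function.Injective fun τ : Set.Ici σ => ((((τ : ℝ) ^ 2 : ℝ)) : 𝕜) := by
    intro τ τ' h
    have h' : (τ : ℝ) ^ 2 = (τ' : ℝ) ^ 2 := RCLike.ofReal_injective h
    exact Subtype.ext ((sq_eq_sq₀ (hσ.trans τ.2) (hσ.trans τ'.2)).1 h')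
  have horth := hsym.orthogonalFamily_eigenspaces.comp hinj
  rw [singularSubspace, Submodule.mem_iSup_iff_exists_finsupp] at hv
  obtain ⟨f, hf, rfl⟩ := hv
  let g : ∀ τ : Set.Ici σ, Module.End.eigenspace ((A : E →L[𝕜] E) : Module.End 𝕜 E)
    ((((τ : ℝ) ^ 2 : ℝ)) : 𝕜) := fun τ => ⟨f τ, hf τ⟩
  let g' : ∀ τ : Set.Ici σ, Module.End.eigenspace ((A : E →L[𝕜] E) : Module.End 𝕜 E)
    ((((τ : ℝ) ^ 2 : ℝ)) : 𝕜) := fun τ => ((((τ : ℝ) ^ 2 : ℝ)) : 𝕜) • g τ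
  set v := f.sum fun _ x => x with hv
  have hvg : v = ∑ τ ∈ f.support, (g τ : E) := rfl
  have hAv : A v = ∑ τ ∈ f.support, (g' τ : E) := by
    rw [hvg, map_sum]
    exact Finset.sum_congr rfl fun τ _ => Module.End.mem_eigenspace_iff.1 (hf τ)
  have h1 : inner 𝕜 (T v) (T v) = ∑ τ ∈ f.support, inner 𝕜 (g τ) (g' τ) := by
    rw [← ContinuousLinearMap.adjoint_inner_right]
    change inner 𝕜 v (A v) = _
    rw [hAv]
    conv_lhs => rw [hvg]
    exact horth.inner_sum g g' f.support
  have h2 : ‖T v‖ ^ 2 = ∑ τ ∈ f.support, (τ : ℝ) ^ 2 * ‖f τ‖ ^ 2 := by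
    rw [inner_self_eq_norm_sq_to_K] at h1
    have h3 : ∀ τ : Set.Ici σ, inner 𝕜 (g τ) (g' τ) = (((τ : ℝ) ^ 2 * ‖f τ‖ ^ 2 : ℝ) : 𝕜) := by
      intro τ
      rw [inner_smul_right, inner_self_eq_norm_sq_to_K]
      push_cast
      rfl
    simp only [h3] at h1
    exact_mod_cast h1
  have h4 : ‖v‖ ^ 2 = ∑ τ ∈ f.support, ‖f τ‖ ^ 2 := by
    rw [hvg]
    exact horth.norm_sum g f.support
  refine le_of_sq_le_sq ?_ (norm_nonneg _)
  rw [mul_pow, h4, h2, Finset.mul_sum]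
  refine Finset.sum_le_sum fun τ _ => ?_
  have : σ ≤ τ := τ.2
  gcongr

/-- An operator that is bounded by `c` on a subspace of codimension less than `j` has
`s_j ≤ c`. -/
theorem singularValue_le_of_codim (T : E →L[𝕜] F) {ι : Type*} [Fintype ι] {j : ℕ}
    (hj : Fintype.card ι < j) (ℓ : E →ₗ[𝕜] ι → 𝕜) {c : ℝ} (hc : 0 ≤ c)
    (h : ∀ x, ℓ x = 0 → ‖T x‖ ≤ c * ‖x‖) : singularValue T j ≤ c := by
  refine Real.sSup_le (fun σ hσ => ?_) hc
  obtain ⟨h0, hr⟩ := hσ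
  -- The singular subspace has rank at least `j`, more than the number of conditions, so `ℓ` has a
  -- nonzero kernel vector in it.
  obtain ⟨x, hx, hℓ, hne⟩ : ∃ x ∈ singularSubspace T σ, ℓ x = 0 ∧ x ≠ 0 := by
    by_contra! hcon
    have hinj : Function.Injective (ℓ.domRestrict (singularSubspace T σ)) := by
      refine (injective_iff_map_eq_zero _).2 fun x hx => ?_
      exact Subtype.ext (hcon x x.2 hx)
    have := LinearMap.lift_rank_le_of_injective _ hinj
    rw [rank_fun'] at this
    have h5 := (Cardinal.lift_le.2 hr).trans this
    simp only [Cardinal.lift_natCast, Nat.cast_le] at h5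
    omega
  have hpos : 0 < ‖x‖ := norm_pos_iff.2 hne
  exact le_of_mul_le_mul_right
    ((mul_norm_le_of_mem_singularSubspace T h0.le hx).trans (h x hℓ)) hpos

end SingularValueBound

/-! ### Cell means and the decay estimate -/

theorem exists_linearMap_partition_means {𝕜 : Type*} [RCLike 𝕜] {a b : ℝ} (hab : a < b)
    (n : ℕ) :
    ∃ L : ℕ → L2 𝕜 a b →ₗ[𝕜] 𝕜, ∀ k < n, ∀ u, L k u =
      ∫ s in Set.Ioo (a + k * ((b - a) / n)) (a + (k + 1 : ℕ) * ((b - a) / n)), u s := by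
  let I : ℕ → Set ℝ := fun k =>
    Set.Ioo (a + k * ((b - a) / n)) (a + (k + 1 : ℕ) * ((b - a) / n))
  have hI : ∀ k, intervalMeasure a b (I k) ≠ ⊤ := fun k => measure_ne_top _ _
  refine ⟨fun k => (innerSL 𝕜 (indicatorConstLp 2 measurableSet_Ioo (hI k) (1 : 𝕜)) :
    L2 𝕜 a b →ₗ[𝕜] 𝕜), fun k hk u => ?_⟩
  obtain ⟨h1, h2⟩ := uniform_partition_cell_bounds hab hk
  have h3 : (intervalMeasure a b).restrict (I k) = volume.restrict (I k) :=
    Measure.restrict_restrict_of_subset (Set.Ioo_subset_Ioo h1 h2)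
  change inner 𝕜 (indicatorConstLp 2 measurableSet_Ioo (hI k) (1 : 𝕜)) u = ∫ s in I k, u s
  rw [L2.inner_indicatorConstLp_one measurableSet_Ioo (hI k) u, h3]

theorem mainTheorem4 {𝕜 : Type*} [RCLike 𝕜] (a b : ℝ) (hab : a < b) (m : ℕ) (hm : 1 ≤ m)
    (k : ℝ × ℝ → 𝕜) (hk : MemLp k 2 ((intervalMeasure a b).prod (intervalMeasure a b)))
    (hrange : ∀ x : L2 𝕜 a b, MemHm m (integralOperator k hk x)) :
    ∃ C : ℝ, 0 < C ∧ ∀ j : ℕ, 1 ≤ j →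
      singularValue (integralOperator k hk) j ≤ C * (j : ℝ) ^ (-(m : ℤ)) := by
  set K := integralOperator k hk
  -- Orders above `m` receive the dummy value 0, so that `D` is indexed by all of `ℕ`.
  have hex : ∀ i, ∃ D : L2 𝕜 a b →ₗ[𝕜] L2 𝕜 a b, i ≤ m → ∀ x, IsWeakDeriv i (K x) (D x) := by
    intro i
    by_cases hi : i ≤ m
    · obtain ⟨D, hD⟩ := exists_linearMap_isWeakDeriv (K : L2 𝕜 a b →ₗ[𝕜] L2 𝕜 a b)
        fun x => hrange x i hi
      exact ⟨D, fun _ => hD⟩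
    · exact ⟨0, fun h => absurd h hi⟩
  choose D hD using hex
  obtain ⟨M, hM, hDM⟩ := exists_bound_of_isWeakDeriv K (D m) (hD m le_rfl)
  have hba : 0 < b - a := sub_pos.2 hab
  have hm' : (0 : ℝ) < m := Nat.cast_pos.2 hm
  -- The first summand serves `j > m`, the second `j ≤ m`, where `s_j ≤ ‖K‖` suffices.
  refine ⟨M * (2 * m * (b - a)) ^ m + ‖K‖ * (m : ℝ) ^ m, by positivity, fun j hj => ?_⟩
  have hj' : (0 : ℝ) < j := Nat.cast_pos.2 hj
  rw [zpow_neg, zpow_natCast, ← div_eq_mul_inv, add_div]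
  rcases le_or_gt j m with hjm | hjm
  · have h1 : singularValue K j ≤ ‖K‖ :=
      singularValue_le_of_codim K (ι := Fin 0) (by rw [Fintype.card_fin]; exact hj) 0 (norm_nonneg _)
        fun x _ => K.le_opNorm x
    have h2 : ‖K‖ ≤ ‖K‖ * (m : ℝ) ^ m / (j : ℝ) ^ m := by
      rw [le_div_iff₀ (by positivity)]
      gcongr
    have h3 : 0 ≤ M * (2 * m * (b - a)) ^ m / (j : ℝ) ^ m := by positivity
    linarith
  -- The largest `n` with `m * n < j`. As `j > m`, it is positive, and `j ≤ m * n + m ≤ 2 * m * n`.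
  · set n := (j - 1) / m with hn
    have hn1 : 0 < n := Nat.div_pos (by omega) hm
    have hmn : m * n < j := (Nat.mul_div_le (j - 1) m).trans_lt (by omega)
    have hjn : j ≤ 2 * m * n := by
      have h1 : j - 1 < m * (n + 1) := Nat.lt_mul_div_succ (j - 1) hm
      have h2 : m * 1 ≤ m * n := Nat.mul_le_mul_left m hn1
      have h3 : 2 * m * n = m * n + m * n := by ring
      rw [mul_add] at h1
      omega
    have hn' : (0 : ℝ) < n := Nat.cast_pos.2 hn1
    obtain ⟨L, hL⟩ := exists_linearMap_partition_means (𝕜 := 𝕜) hab n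
    have h1 : singularValue K j ≤ ((b - a) / n) ^ m * M := by
      refine singularValue_le_of_codim K (ι := Fin m × Fin n) (by simpa using hmn)
        (LinearMap.pi fun p => (L p.2).comp (D p.1)) (by positivity) fun x hx => ?_
      -- Each use of Poincaré trades one derivative for a factor `(b - a) / n`; only the means of `D
      -- i x` with `i < m` are needed.
      have hstep : ∀ i ≤ m, ‖K x‖ ≤ ((b - a) / n) ^ i * ‖D i x‖ := by
        intro i
        induction i with
        | zero =>
          intro _
          rw [(hD 0 (Nat.zero_le _) x).unique (IsWeakDeriv.zero (K x)), pow_zero, one_mul]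
        | succ i ih =>
          intro hi
          refine (ih (by omega)).trans ?_
          rw [pow_succ, mul_assoc]
          gcongr
          refine IsWeakDeriv.norm_le_of_partition_means_eq_zero hab
            ((hD i (by omega) x).one_of_succ (hD (i + 1) hi x)) hn1 fun r hr => ?_
          rw [← hL r hr]
          exact congrFun hx (⟨i, hi⟩, ⟨r, hr⟩)
      refine (hstep m le_rfl).trans ?_
      rw [mul_assoc]
      gcongr
      exact hDM x
    have h2 : ((b - a) / n) ^ m * M ≤ M * (2 * m * (b - a)) ^ m / (j : ℝ) ^ m := by
      rw [mul_comm, mul_div_assoc, ← div_pow]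
      have : (b - a) / n ≤ 2 * m * (b - a) / j := by
        rw [div_le_div_iff₀ hn' hj']
        have : (j : ℝ) ≤ 2 * m * n := by exact_mod_cast hjn
        nlinarith
      gcongr
    have h3 : 0 ≤ ‖K‖ * (m : ℝ) ^ m / (j : ℝ) ^ m := by positivity
    linarith
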